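/- All graphs and digraphs are finite; graphs are simple, and digraphs have neither loops nor parallel arcs. For positive integers $i,j$, an $\langle i,j\rangle$ digraph is a digraph in which every vertex has indegree at most $i$ and outdegree at most $j$. The competition graph of a digraph $D$ is the graph on the vertex set of $D$ in which two distinct vertices are adjacent if and only if they have a common out-neighbor in $D$. A graph is an $\langle i,j\rangle$ competition graph if it is the competition graph of some $\langle i,j\rangle$ digraph. Let $\omega(G)$ denote the clique number of $G$, that is, the number of vertices in a maximum clique of $G$. Then the following hold for all positive integers $i$ and $j$. (a) If $i>j\ge 2$, then every $\langle i,j\rangle$ competition graph $G$ satisfies $\omega(G)<ij-j+1$. (b) There is a $\langle 2,j\rangle$ competition graph $G$ with $\omega(G)=j+1$. (c) There is a $\langle 3,j\rangle$ competition graph $G$ with $\omega(G)=2j+1$ if and only if $j=1$, or $j=3n$ or $j=3n+1$ for some integer $n\ge 1$. -/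

import Mathlib

/-- An `⟨i, j⟩` digraph: a loopless digraph (without parallel arcs) in which every vertex has
indegree at most `i` and outdegree at most `j`. -/
structure IsBoundedDigraph {V : Type*} (i j : ℕ) (D : Digraph V) : Prop where
  loopless : ∀ v, ¬ D.Adj v v
  indegree_le : ∀ v, {u | D.Adj u v}.encard ≤ i
  outdegree_le : ∀ v, {w | D.Adj v w}.encard ≤ j

/-- The competition graph of a digraph `D`: the simple graph on the vertices of `D` in which two
distinct vertices are adjacent if and only if they have a common out-neighbor in `D`. -/
def competitionGraph {V : Type*} (D : Digraph V) : SimpleGraph V where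
  Adj u v := u ≠ v ∧ ∃ w, D.Adj u w ∧ D.Adj v w
  symm := ⟨fun _ _ h => ⟨h.1.symm, h.2.imp fun _ hw => ⟨hw.2, hw.1⟩⟩⟩
  loopless := ⟨fun _ h => h.1 rfl⟩

/-- A graph is an `⟨i, j⟩` competition graph if it is the competition graph of some `⟨i, j⟩`
digraph. -/
def IsBoundedCompetitionGraph {V : Type*} (i j : ℕ) (G : SimpleGraph V) : Prop :=
  ∃ D : Digraph V, IsBoundedDigraph i j D ∧ competitionGraph D = G

/-!
The common out-neighbours of the vertices of a clique `s` of the competition graph act as blocks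
covering every pair of points of `s`. If blocks have at most `k + 1` points and every point lies
on at most `j` blocks, counting the pairs through one point gives `#s ≤ j * k + 1`. Equality forces
a Steiner system: all blocks have `k + 1` points, all points lie on `j` blocks, and two points lie
on a unique block. The blocks joining a point `q` to the `k + 1` points of a block missing `q` are
then distinct, so `k < j`; and counting incidences gives `k + 1 ∣ (j * k + 1) * j`, which for
`k = 2` means `j % 3 ≠ 2`. Conversely, a Steiner system yields a digraph with an arc from each
point to each block through it: for `k = 1` take all pairs of `j + 1` points, for `k = 2` the triple
systems of Bose and Skolem.
-/

open Finset Function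

section PairCovering

variable {P W : Type*}

/-- The points `s` and the blocks `t`, with incidence relation `r`, form a pair covering: blocks
have at most `m` points, and any two distinct points lie on a common block. When all blocks have `m`
points and the common blocks are unique, this is a Steiner system `S(2, m, #s)`. -/
structure IsPairCovering (r : P → W → Prop) [∀ p w, Decidable (r p w)] (m : ℕ) (s : Finset P)
    (t : Finset W) : Prop where
  card_block_le : ∀ w ∈ t, #(s.bipartiteBelow r w) ≤ m
  exists_block : (s : Set P).Pairwise fun p q ↦ ∃ w ∈ t, r p w ∧ r q w

variable {r : P → W → Prop} [∀ p w, Decidable (r p w)] {k j : ℕ} {s : Finset P} {t : Finset W}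
  {p q : P} {w w' : W}

lemma card_bipartiteBelow_erase_add_one [DecidableEq P] (hp : p ∈ s) (hpw : r p w) :
    #((s.erase p).bipartiteBelow r w) + 1 = #(s.bipartiteBelow r w) := by
  have herase : (s.erase p).bipartiteBelow r w = (s.bipartiteBelow r w).erase p := by
    ext
    simp [and_assoc]
  rw [herase, card_erase_add_one ((mem_bipartiteBelow r).2 ⟨hp, hpw⟩)]

namespace IsPairCovering

lemma of_blocks [Fintype P] [Fintype W] [DecidableEq P] {b : W → Finset P} {m : ℕ}
    (hb : ∀ w, #(b w) ≤ m) (hpair : ∀ p q, p ≠ q → ∃ w, p ∈ b w ∧ q ∈ b w) :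
    IsPairCovering (fun p w ↦ p ∈ b w) m univ univ where
  card_block_le w _ := by simpa [bipartiteBelow] using hb w
  exists_block p _ q _ hpq := by simpa using hpair p q hpq

section OnePoint

variable [DecidableEq P]

lemma card_block_erase_le (h : IsPairCovering r (k + 1) s t) (hp : p ∈ s)
    (hw : w ∈ t.bipartiteAbove r p) : #((s.erase p).bipartiteBelow r w) ≤ k := by
  obtain ⟨hwt, hpw⟩ := (mem_bipartiteAbove r).1 hw
  have hcard := card_bipartiteBelow_erase_add_one hp hpw
  have hle := h.card_block_le w hwt
  omega

lemma one_le_card_common (h : IsPairCovering r (k + 1) s t) (hp : p ∈ s) (hq : q ∈ s.erase p) :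
    1 ≤ #((t.bipartiteAbove r p).bipartiteAbove r q) := by
  obtain ⟨hqp, hqs⟩ := mem_erase.1 hq
  obtain ⟨w, hw, hpw, hqw⟩ := h.exists_block hp hqs hqp.symm
  exact card_pos.2 ⟨w, by simp [hw, hpw, hqw]⟩

lemma card_erase_le_sum_card_common (h : IsPairCovering r (k + 1) s t) (hp : p ∈ s) :
    #(s.erase p) ≤ ∑ q ∈ s.erase p, #((t.bipartiteAbove r p).bipartiteAbove r q) := by
  simpa using card_nsmul_le_sum _ _ 1 fun q hq ↦ h.one_le_card_common hp hq

lemma sum_card_common_le (h : IsPairCovering r (k + 1) s t) (hp : p ∈ s) :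
    ∑ q ∈ s.erase p, #((t.bipartiteAbove r p).bipartiteAbove r q) ≤
      #(t.bipartiteAbove r p) * k := by
  rw [sum_card_bipartiteAbove_eq_sum_card_bipartiteBelow]
  exact sum_le_card_nsmul _ _ _ fun w hw ↦ h.card_block_erase_le hp hw

end OnePoint

lemma card_le_degree_mul_add_one (h : IsPairCovering r (k + 1) s t) (hp : p ∈ s) :
    #s ≤ #(t.bipartiteAbove r p) * k + 1 := by
  classical
  rw [← card_erase_add_one hp]
  gcongr
  exact (h.card_erase_le_sum_card_common hp).trans (h.sum_card_common_le hp)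

lemma card_le_mul_add_one (h : IsPairCovering r (k + 1) s t)
    (hdeg : ∀ p ∈ s, #(t.bipartiteAbove r p) ≤ j) : #s ≤ j * k + 1 := by
  obtain rfl | ⟨p, hp⟩ := s.eq_empty_or_nonempty
  · simp
  · exact (h.card_le_degree_mul_add_one hp).trans (by gcongr; exact hdeg p hp)

section Extremal

variable (h : IsPairCovering r (k + 1) s t) (hcard : #s = j * k + 1)
include h hcard

lemma le_degree (hk : 0 < k) (hp : p ∈ s) : j ≤ #(t.bipartiteAbove r p) := by
  have hle := h.card_le_degree_mul_add_one hp
  exact Nat.le_of_mul_le_mul_right (by omega) hk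

lemma degree_le_of_card_blocks_le (hk : 0 < k) (ht : (k + 1) * #t ≤ #s * j) (hp : p ∈ s) :
    #(t.bipartiteAbove r p) ≤ j := by
  have hsum : ∑ p ∈ s, #(t.bipartiteAbove r p) ≤ ∑ _p ∈ s, j := calc
    _ = ∑ w ∈ t, #(s.bipartiteBelow r w) := sum_card_bipartiteAbove_eq_sum_card_bipartiteBelow r
    _ ≤ #t * (k + 1) := sum_le_card_nsmul _ _ _ h.card_block_le
    _ ≤ ∑ _p ∈ s, j := by rwa [sum_const, smul_eq_mul, mul_comm]
  have hge : ∀ p ∈ s, j ≤ #(t.bipartiteAbove r p) := fun p hp ↦ h.le_degree hcard hk hp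
  exact ((sum_eq_sum_iff_of_le hge).1 ((sum_le_sum hge).antisymm hsum) p hp).ge

variable (hdeg : ∀ p ∈ s, #(t.bipartiteAbove r p) ≤ j)
include hdeg

lemma sum_card_common_eq [DecidableEq P] (hp : p ∈ s) :
    ∑ q ∈ s.erase p, #((t.bipartiteAbove r p).bipartiteAbove r q) = j * k := by
  refine ((h.sum_card_common_le hp).trans (by gcongr; exact hdeg p hp)).antisymm ?_
  have := h.card_erase_le_sum_card_common hp
  rwa [card_erase_of_mem hp, hcard, Nat.add_sub_cancel] at this

lemma card_common_eq_one [DecidableEq P] (hp : p ∈ s) (hq : q ∈ s.erase p) :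
    #((t.bipartiteAbove r p).bipartiteAbove r q) = 1 := by
  refine ((sum_eq_sum_iff_of_le fun q hq ↦ h.one_le_card_common hp hq).1 ?_ q hq).symm
  rw [h.sum_card_common_eq hcard hdeg hp, sum_const, card_erase_of_mem hp, hcard]
  simp

lemma block_unique (hp : p ∈ s) (hq : q ∈ s) (hpq : p ≠ q) (hw : w ∈ t) (hpw : r p w)
    (hqw : r q w) (hw' : w' ∈ t) (hpw' : r p w') (hqw' : r q w') : w = w' := by
  classical
  have hone := h.card_common_eq_one hcard hdeg hp (mem_erase.2 ⟨hpq.symm, hq⟩)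
  exact card_le_one.1 hone.le w (by simp [hw, hpw, hqw]) w' (by simp [hw', hpw', hqw'])

lemma card_block_eq (hp : p ∈ s) (hw : w ∈ t) (hpw : r p w) :
    #(s.bipartiteBelow r w) = k + 1 := by
  classical
  have hle : ∀ w ∈ t.bipartiteAbove r p, #((s.erase p).bipartiteBelow r w) ≤ k :=
    fun w hw ↦ h.card_block_erase_le hp hw
  have hsum := h.sum_card_common_eq hcard hdeg hp
  rw [sum_card_bipartiteAbove_eq_sum_card_bipartiteBelow] at hsum
  have heq : #((s.erase p).bipartiteBelow r w) = k := by
    refine (sum_eq_sum_iff_of_le hle).1 ((sum_le_sum hle).antisymm ?_) w (by simp [hw, hpw])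
    rw [hsum, sum_const, smul_eq_mul]
    gcongr
    exact hdeg p hp
  rw [← card_bipartiteBelow_erase_add_one hp hpw, heq]

lemma lt_of_two_le (hj : 2 ≤ j) : k < j := by
  obtain rfl | hk := k.eq_zero_or_pos
  · omega
  obtain ⟨p, hp⟩ : s.Nonempty := card_pos.1 (by omega)
  obtain ⟨w, hw⟩ : (t.bipartiteAbove r p).Nonempty :=
    card_pos.1 (by have := h.le_degree hcard hk hp; omega)
  obtain ⟨hwt, hpw⟩ := (mem_bipartiteAbove r).1 hw
  have hblock : #(s.bipartiteBelow r w) = k + 1 := h.card_block_eq hcard hdeg hp hwt hpw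
  obtain ⟨q, hq, hqw⟩ : ∃ q ∈ s, q ∉ s.bipartiteBelow r w := by
    refine exists_mem_notMem_of_card_lt_card ?_
    nlinarith
  have hqw : ¬ r q w := fun hr ↦ hqw ((mem_bipartiteBelow r).2 ⟨hq, hr⟩)
  have hinj : #(s.bipartiteBelow r w) ≤ #(t.bipartiteAbove r q) := by
    refine card_le_card_of_forall_subsingleton r (fun x hx ↦ ?_) ?_
    · obtain ⟨hxs, hxw⟩ := (mem_bipartiteBelow r).1 hx
      obtain ⟨y, hy, hxy, hqy⟩ := h.exists_block hxs hq (by rintro rfl; exact hqw hxw)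
      exact ⟨y, (mem_bipartiteAbove r).2 ⟨hy, hqy⟩, hxy⟩
    · rintro y hy a ⟨ha, hay⟩ b ⟨hb, hby⟩
      obtain ⟨hyt, hqy⟩ := (mem_bipartiteAbove r).1 hy
      obtain ⟨has, haw⟩ := (mem_bipartiteBelow r).1 ha
      obtain ⟨hbs, hbw⟩ := (mem_bipartiteBelow r).1 hb
      by_contra hab
      obtain rfl := h.block_unique hcard hdeg has hbs hab hyt hay hby hwt haw hbw
      exact hqw hqy
  have := hdeg q hq
  omega

lemma succ_dvd_card_mul (hk : 0 < k) : k + 1 ∣ #s * j := by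
  have hsum : ∑ w ∈ t, #(s.bipartiteBelow r w) = #s * j := by
    rw [← sum_card_bipartiteAbove_eq_sum_card_bipartiteBelow]
    exact sum_const_nat fun p hp ↦ (hdeg p hp).antisymm (h.le_degree hcard hk hp)
  rw [← hsum]
  refine dvd_sum fun w hw ↦ ?_
  obtain hempty | ⟨p, hp⟩ := (s.bipartiteBelow r w).eq_empty_or_nonempty
  · simp [hempty]
  · obtain ⟨hps, hpw⟩ := (mem_bipartiteBelow r).1 hp
    rw [h.card_block_eq hcard hdeg hps hw hpw]

end Extremal

end IsPairCovering

end PairCovering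

section Clique

variable {V : Type*} {D : Digraph V} {i j k : ℕ} {s : Finset V}

open Classical in
lemma IsBoundedDigraph.exists_isPairCovering (hD : IsBoundedDigraph i j D)
    (hs : (competitionGraph D).IsClique s) :
    ∃ t : Finset V, IsPairCovering D.Adj i s t ∧ ∀ v ∈ s, #(t.bipartiteAbove D.Adj v) ≤ j := by
  have hfin : (⋃ v ∈ s, {w | D.Adj v w}).Finite :=
    s.finite_toSet.biUnion fun v _ ↦ Set.finite_of_encard_le_coe (hD.outdegree_le v)
  refine ⟨hfin.toFinset, ⟨fun w _ ↦ ?_, fun u hu v hv huv ↦ ?_⟩, fun v _ ↦ ?_⟩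
  · have hle : ((s.bipartiteBelow D.Adj w : Finset V) : Set V).encard ≤ i :=
      (Set.encard_le_encard fun u hu ↦ by simp_all).trans (hD.indegree_le w)
    rw [Set.encard_coe_eq_coe_finsetCard] at hle
    exact_mod_cast hle
  · obtain ⟨w, huw, hvw⟩ := (hs hu hv huv).2
    exact ⟨w, hfin.mem_toFinset.2 (Set.mem_biUnion hu huw), huw, hvw⟩
  · have hle : ((hfin.toFinset.bipartiteAbove D.Adj v : Finset V) : Set V).encard ≤ j :=
      (Set.encard_le_encard fun w hw ↦ ((mem_bipartiteAbove _).1 hw).2).trans (hD.outdegree_le v)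
    rw [Set.encard_coe_eq_coe_finsetCard] at hle
    exact_mod_cast hle

open Classical in
lemma IsBoundedDigraph.exists_isPairCovering_card_eq_cliqueNum (hD : IsBoundedDigraph i j D) :
    ∃ s t : Finset V, IsPairCovering D.Adj i s t ∧ #s = (competitionGraph D).cliqueNum ∧
      ∀ v ∈ s, #(t.bipartiteAbove D.Adj v) ≤ j := by
  obtain ⟨s, hs⟩ := (competitionGraph D).exists_isNClique_cliqueNum
  obtain ⟨t, ht, hdeg⟩ := hD.exists_isPairCovering hs.isClique
  exact ⟨s, t, ht, hs.card_eq, hdeg⟩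

lemma IsBoundedDigraph.cliqueNum_le (hD : IsBoundedDigraph (k + 1) j D) :
    (competitionGraph D).cliqueNum ≤ j * k + 1 := by
  classical
  obtain ⟨s, t, h, hs, hdeg⟩ := hD.exists_isPairCovering_card_eq_cliqueNum
  exact hs ▸ h.card_le_mul_add_one hdeg

lemma IsBoundedDigraph.lt_of_cliqueNum_eq (hD : IsBoundedDigraph (k + 1) j D) (hj : 2 ≤ j)
    (hω : (competitionGraph D).cliqueNum = j * k + 1) : k < j := by
  classical
  obtain ⟨s, t, h, hs, hdeg⟩ := hD.exists_isPairCovering_card_eq_cliqueNum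
  exact h.lt_of_two_le (hs.trans hω) hdeg hj

lemma IsBoundedDigraph.succ_dvd_of_cliqueNum_eq (hD : IsBoundedDigraph (k + 1) j D) (hk : 0 < k)
    (hω : (competitionGraph D).cliqueNum = j * k + 1) : k + 1 ∣ (j * k + 1) * j := by
  classical
  obtain ⟨s, t, h, hs, hdeg⟩ := hD.exists_isPairCovering_card_eq_cliqueNum
  rw [← hω, ← hs]
  exact h.succ_dvd_card_mul (hs.trans hω) hdeg hk

end Clique

section IncidenceDigraph

variable {P W : Type*}

/-- The digraph of an incidence structure, with an arc from each point to each block containing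
it. -/
def incidenceDigraph (r : P → W → Prop) : Digraph (P ⊕ W) where
  Adj u v := ∃ p w, u = .inl p ∧ v = .inr w ∧ r p w

variable [Fintype P] [Fintype W] {r : P → W → Prop} [∀ p w, Decidable (r p w)] {i j k : ℕ}

lemma isBoundedDigraph_incidenceDigraph (hin : ∀ w, #(univ.bipartiteBelow r w) ≤ i)
    (hout : ∀ p, #(univ.bipartiteAbove r p) ≤ j) :
    IsBoundedDigraph i j (incidenceDigraph r) where
  loopless := by rintro v ⟨p, w, rfl, h, -⟩; cases h
  indegree_le := by
    rintro (p | w)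
    · simp [incidenceDigraph]
    · have : {u | (incidenceDigraph r).Adj u (.inr w)} =
          ((univ.bipartiteBelow r w).map .inl : Finset (P ⊕ W)) := by
        ext; simp [incidenceDigraph, and_comm, eq_comm]
      rw [this, Set.encard_coe_eq_coe_finsetCard, card_map]
      exact_mod_cast hin w
  outdegree_le := by
    rintro (p | w)
    · have : {v | (incidenceDigraph r).Adj (.inl p) v} =
          ((univ.bipartiteAbove r p).map .inr : Finset (P ⊕ W)) := by
        ext; simp [incidenceDigraph, and_comm, eq_comm]
      rw [this, Set.encard_coe_eq_coe_finsetCard, card_map]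
      exact_mod_cast hout p
    · simp [incidenceDigraph]

lemma IsPairCovering.isClique_competitionGraph (h : IsPairCovering r k univ univ) :
    (competitionGraph (incidenceDigraph r)).IsClique
      ((univ : Finset P).map .inl : Finset (P ⊕ W)) := by
  intro u hu v hv huv
  obtain ⟨p, -, rfl⟩ := mem_map.1 (mem_coe.1 hu)
  obtain ⟨q, -, rfl⟩ := mem_map.1 (mem_coe.1 hv)
  obtain ⟨w, -, hpw, hqw⟩ :=
    h.exists_block (mem_coe.2 (mem_univ p)) (mem_coe.2 (mem_univ q)) (by rintro rfl; exact huv rfl)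
  exact ⟨huv, .inr w, ⟨p, w, rfl, rfl, hpw⟩, ⟨q, w, rfl, rfl, hqw⟩⟩

end IncidenceDigraph

lemma IsPairCovering.exists_isBoundedCompetitionGraph.{u, v} {P : Type u} {W : Type v}
    [Fintype P] [Fintype W] {r : P → W → Prop} [∀ p w, Decidable (r p w)] {j k : ℕ}
    (h : IsPairCovering r (k + 1) univ univ) (hk : 0 < k) (hP : Fintype.card P = j * k + 1)
    (hW : (k + 1) * Fintype.card W ≤ (j * k + 1) * j) :
    ∃ (V : Type (max u v)) (_ : Finite V) (G : SimpleGraph V),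
      IsBoundedCompetitionGraph (k + 1) j G ∧ G.cliqueNum = j * k + 1 := by
  have hdeg (p : P) : #(univ.bipartiteAbove r p) ≤ j :=
    h.degree_le_of_card_blocks_le hP hk (by rwa [card_univ, card_univ, hP]) (mem_univ p)
  have hD : IsBoundedDigraph (k + 1) j (incidenceDigraph r) :=
    isBoundedDigraph_incidenceDigraph (fun w ↦ h.card_block_le w (mem_univ w)) hdeg
  refine ⟨P ⊕ W, inferInstance, competitionGraph _, ⟨_, hD, rfl⟩, hD.cliqueNum_le.antisymm ?_⟩
  rw [← hP, ← card_univ, ← card_map .inl]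
  exact h.isClique_competitionGraph.card_le_cliqueNum

lemma exists_isBoundedCompetitionGraph_two (j : ℕ) :
    ∃ (V : Type) (_ : Finite V) (G : SimpleGraph V),
      IsBoundedCompetitionGraph 2 j G ∧ G.cliqueNum = j + 1 := by
  have hcover : IsPairCovering (fun p (e : {e : Finset (Fin (j + 1)) // #e = 2}) ↦ p ∈ e.1)
      2 univ univ :=
    .of_blocks (fun e ↦ e.2.le) fun p q hpq ↦ ⟨⟨{p, q}, card_pair hpq⟩, by simp, by simp⟩
  simpa using hcover.exists_isBoundedCompetitionGraph (j := j) one_pos (by simp) (by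
    rw [Fintype.card_finset_len, Fintype.card_fin, Nat.choose_two_right, mul_one]
    exact Nat.mul_div_le _ _)

section TripleSystems

section MixedBlocks

variable {P Q E : Type*} [DecidableEq P]

section AddCommMonoid

variable [AddCommMonoid Q]

/-- The blocks `{(x, i), (y, i), (f (x + y), i + 1)}` with `x ≠ y` of the Steiner triple systems of
Bose and Skolem, transported to the points `P` by `g` and indexed by the pairs `({x, y}, i)`. -/
def mixedBlock (g : Q × ZMod 3 → P) (f : Q → Q) (w : {e : Finset Q // #e = 2} × ZMod 3) :
    Finset P :=
  insert (g (f (∑ x ∈ w.1.1, x), w.2 + 1)) (w.1.1.image fun x ↦ g (x, w.2))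

variable {g : Q × ZMod 3 → P} {f : Q → Q}

lemma card_mixedBlock_le (w : {e : Finset Q // #e = 2} × ZMod 3) : #(mixedBlock g f w) ≤ 3 :=
  (card_insert_le _ _).trans (Nat.succ_le_succ (card_image_le.trans w.1.2.le))

lemma exists_mem_mixedBlock {x y : Q} (hxy : x ≠ y) (i : ZMod 3) :
    ∃ w, g (x, i) ∈ mixedBlock g f w ∧ g (y, i) ∈ mixedBlock g f w ∧
      g (f (x + y), i + 1) ∈ mixedBlock g f w := by
  classical
  exact ⟨(⟨{x, y}, card_pair hxy⟩, i), by simp [mixedBlock, sum_pair hxy]⟩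

end AddCommMonoid

variable [AddCommGroup Q] {g : Q × ZMod 3 → P} {f : Q → Q}

lemma exists_mem_mixedBlock_succ (hf : Surjective f) {x y : Q} (hy : y ≠ f (x + x)) (i : ZMod 3) :
    ∃ w, g (x, i) ∈ mixedBlock g f w ∧ g (y, i + 1) ∈ mixedBlock g f w := by
  obtain ⟨z, rfl⟩ := hf y
  have hne : x ≠ z - x := fun h ↦ hy (by rw [← eq_sub_iff_add_eq.1 h])
  obtain ⟨w, hx, -, hz⟩ := exists_mem_mixedBlock (g := g) (f := f) hne i
  exact ⟨w, hx, by rwa [add_sub_cancel] at hz⟩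

lemma exists_block_of_exists_double {c : E → Finset P} (hf : Surjective f)
    (hc : ∀ x i, ∃ e, g (x, i) ∈ c e ∧ g (f (x + x), i + 1) ∈ c e) {u v : Q × ZMod 3}
    (huv : u ≠ v) :
    ∃ w, g u ∈ Sum.elim c (mixedBlock g f) w ∧ g v ∈ Sum.elim c (mixedBlock g f) w := by
  have hsucc (x y : Q) (i : ZMod 3) : ∃ w, g (x, i) ∈ Sum.elim c (mixedBlock g f) w ∧
      g (y, i + 1) ∈ Sum.elim c (mixedBlock g f) w := by
    by_cases hy : y = f (x + x)
    · obtain ⟨e, he⟩ := hc x i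
      exact ⟨.inl e, hy ▸ he⟩
    · obtain ⟨w, hw⟩ := exists_mem_mixedBlock_succ (g := g) hf hy i
      exact ⟨.inr w, hw⟩
  obtain ⟨x, i⟩ := u
  obtain ⟨y, l⟩ := v
  have hlevel : ∀ i l : ZMod 3, l = i ∨ l = i + 1 ∨ i = l + 1 := by decide
  obtain rfl | rfl | rfl := hlevel i l
  · obtain ⟨w, hx, hy, -⟩ := exists_mem_mixedBlock (g := g) (f := f)
      (fun hxy : x = y ↦ huv (by rw [hxy])) l
    exact ⟨.inr w, hx, hy⟩
  · exact hsucc x y i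
  · exact (hsucc y x l).imp fun w ↦ And.symm

end MixedBlocks

section Bose

variable (n : ℕ)

/-- Halving modulo the odd number `2 * n + 1`. -/
def oddHalf (z : ZMod (2 * n + 1)) : ZMod (2 * n + 1) := (n + 1) * z

lemma oddHalf_add_self (x : ZMod (2 * n + 1)) : oddHalf n (x + x) = x := by
  have hzero : (2 * n + 1 : ZMod (2 * n + 1)) = 0 := by
    exact_mod_cast ZMod.natCast_self (2 * n + 1)
  rw [oddHalf]
  linear_combination x * hzero

/-- The blocks of Bose's Steiner triple system on the `6 * n + 3` points
`ZMod (2 * n + 1) × ZMod 3`. -/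
def boseBlock : ZMod (2 * n + 1) ⊕ {e : Finset (ZMod (2 * n + 1)) // #e = 2} × ZMod 3 →
    Finset (ZMod (2 * n + 1) × ZMod 3) :=
  Sum.elim (fun x ↦ {x} ×ˢ univ) (mixedBlock id (oddHalf n))

lemma isPairCovering_boseBlock :
    IsPairCovering (fun p w ↦ p ∈ boseBlock n w) 3 univ univ := by
  refine .of_blocks ?_ fun p q hpq ↦ exists_block_of_exists_double (g := id)
    (fun x ↦ ⟨x + x, oddHalf_add_self n x⟩) (fun x i ↦ ⟨x, ?_⟩) hpq
  · rintro (x | w)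
    · simp [boseBlock, ZMod.card]
    · exact card_mixedBlock_le w
  · simp [oddHalf_add_self]

lemma exists_isBoundedCompetitionGraph_bose :
    ∃ (V : Type) (_ : Finite V) (G : SimpleGraph V),
      IsBoundedCompetitionGraph 3 (3 * n + 1) G ∧ G.cliqueNum = (3 * n + 1) * 2 + 1 := by
  refine (isPairCovering_boseBlock n).exists_isBoundedCompetitionGraph two_pos ?_ ?_
  · rw [Fintype.card_prod, ZMod.card, ZMod.card]
    ring
  · have hchoose : (2 * n + 1).choose 2 = (2 * n + 1) * n := by
      rw [Nat.choose_two_right, Nat.add_sub_cancel, Nat.mul_div_assoc _ (dvd_mul_right 2 n),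
        Nat.mul_div_cancel_left _ two_pos]
    rw [Fintype.card_sum, Fintype.card_prod, Fintype.card_finset_len, ZMod.card, ZMod.card, hchoose]
    exact le_of_eq (by ring)

end Bose

section Skolem

variable (n : ℕ)

/-- Skolem's substitute for halving modulo `2 * n`: it sends `2 * a` to `a` and `2 * a + 1` to
`a + n`, for `a < n`. -/
def evenHalf (z : ZMod (2 * n)) : ZMod (2 * n) := ((z.val / 2 + z.val % 2 * n : ℕ) : ZMod (2 * n))

variable {n}

lemma evenHalf_add_self {a : ℕ} (ha : a < n) : evenHalf n (a + a) = a := by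
  rw [evenHalf, ← Nat.cast_add, ZMod.val_natCast, Nat.mod_eq_of_lt (by omega)]
  congr 1
  rw [show (a + a) % 2 = 0 by omega]
  omega

lemma evenHalf_add_self_add_one {a : ℕ} (ha : a < n) : evenHalf n (a + a + 1) = a + n := by
  rw [evenHalf, ← Nat.cast_add, ← Nat.cast_succ, ZMod.val_natCast, Nat.mod_eq_of_lt (by omega),
    ← Nat.cast_add]
  congr 1
  rw [show (a + a).succ % 2 = 1 by omega]
  omega

lemma natCast_add_add_self (a : ℕ) : (a + n + (a + n) : ZMod (2 * n)) = a + a := by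
  have hzero : (2 * n : ZMod (2 * n)) = 0 := by exact_mod_cast ZMod.natCast_self (2 * n)
  linear_combination hzero

lemma exists_eq_natCast_or_eq_natCast_add [NeZero n] (x : ZMod (2 * n)) :
    ∃ a < n, x = a ∨ x = a + n := by
  have hlt := ZMod.val_lt x
  have hval := ZMod.natCast_zmod_val x
  obtain hx | hx := lt_or_ge x.val n
  · exact ⟨x.val, hx, .inl hval.symm⟩
  · exact ⟨x.val - n, by omega, .inr (by rw [← Nat.cast_add, Nat.sub_add_cancel hx, hval])⟩

lemma evenHalf_surjective [NeZero n] : Surjective (evenHalf n) := by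
  intro y
  obtain ⟨a, ha, rfl | rfl⟩ := exists_eq_natCast_or_eq_natCast_add y
  · exact ⟨_, evenHalf_add_self ha⟩
  · exact ⟨_, evenHalf_add_self_add_one ha⟩

variable (n)

/-- The blocks of Skolem's Steiner triple system that are not mixed: the columns over the lower
half of `ZMod (2 * n)` and the blocks through the point at infinity `none`. -/
def unmixedSkolemBlock : Fin n ⊕ Fin n × ZMod 3 → Finset (Option (ZMod (2 * n) × ZMod 3)) :=
  Sum.elim (fun a ↦ univ.image fun i ↦ some ((a.val : ZMod (2 * n)), i))
    fun w ↦ {none, some ((w.1.val : ZMod (2 * n)) + n, w.2),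
      some ((w.1.val : ZMod (2 * n)), w.2 + 1)}

/-- The blocks of Skolem's Steiner triple system on the `6 * n + 1` points
`Option (ZMod (2 * n) × ZMod 3)`. -/
def skolemBlock :
    (Fin n ⊕ Fin n × ZMod 3) ⊕ {e : Finset (ZMod (2 * n)) // #e = 2} × ZMod 3 →
      Finset (Option (ZMod (2 * n) × ZMod 3)) :=
  Sum.elim (unmixedSkolemBlock n) (mixedBlock some (evenHalf n))

lemma card_unmixedSkolemBlock_le (w : Fin n ⊕ Fin n × ZMod 3) : #(unmixedSkolemBlock n w) ≤ 3 := by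
  obtain a | w := w
  · exact card_image_le
  · exact card_le_three

variable {n} [NeZero n]

lemma exists_mem_unmixedSkolemBlock_double (x : ZMod (2 * n)) (i : ZMod 3) :
    ∃ w, some (x, i) ∈ unmixedSkolemBlock n w ∧
      some (evenHalf n (x + x), i + 1) ∈ unmixedSkolemBlock n w := by
  obtain ⟨a, ha, rfl | rfl⟩ := exists_eq_natCast_or_eq_natCast_add x
  · exact ⟨.inl ⟨a, ha⟩, by simp [unmixedSkolemBlock, evenHalf_add_self ha]⟩
  · exact ⟨.inr (⟨a, ha⟩, i),
      by simp [unmixedSkolemBlock, natCast_add_add_self, evenHalf_add_self ha]⟩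

lemma exists_none_mem_unmixedSkolemBlock (p : ZMod (2 * n) × ZMod 3) :
    ∃ w, none ∈ unmixedSkolemBlock n w ∧ some p ∈ unmixedSkolemBlock n w := by
  obtain ⟨x, i⟩ := p
  obtain ⟨a, ha, rfl | rfl⟩ := exists_eq_natCast_or_eq_natCast_add x
  · exact ⟨.inr (⟨a, ha⟩, i - 1), by simp [unmixedSkolemBlock]⟩
  · exact ⟨.inr (⟨a, ha⟩, i), by simp [unmixedSkolemBlock]⟩

variable (n)

lemma isPairCovering_skolemBlock :
    IsPairCovering (fun p w ↦ p ∈ skolemBlock n w) 3 univ univ := by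
  refine .of_blocks ?_ ?_
  · rintro (w | w)
    · exact card_unmixedSkolemBlock_le n w
    · exact card_mixedBlock_le w
  · have hinf (p : ZMod (2 * n) × ZMod 3) :
        ∃ w, none ∈ skolemBlock n w ∧ some p ∈ skolemBlock n w := by
      obtain ⟨w, hw⟩ := exists_none_mem_unmixedSkolemBlock p
      exact ⟨.inl w, hw⟩
    rintro (_ | p) (_ | q) hpq
    · exact absurd rfl hpq
    · exact hinf q
    · exact (hinf p).imp fun w ↦ And.symm
    · exact exists_block_of_exists_double evenHalf_surjective exists_mem_unmixedSkolemBlock_double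
        (fun h ↦ hpq (by rw [h]))

lemma exists_isBoundedCompetitionGraph_skolem :
    ∃ (V : Type) (_ : Finite V) (G : SimpleGraph V),
      IsBoundedCompetitionGraph 3 (3 * n) G ∧ G.cliqueNum = 3 * n * 2 + 1 := by
  refine (isPairCovering_skolemBlock n).exists_isBoundedCompetitionGraph two_pos ?_ ?_
  · rw [Fintype.card_option, Fintype.card_prod, ZMod.card, ZMod.card]
    ring
  · have hchoose : (2 * n).choose 2 = n * (2 * n - 1) := by
      rw [Nat.choose_two_right, mul_assoc, Nat.mul_div_cancel_left _ two_pos]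
    obtain ⟨m, rfl⟩ := Nat.exists_eq_succ_of_ne_zero (NeZero.ne n)
    simp only [Fintype.card_sum, Fintype.card_prod, Fintype.card_finset_len, ZMod.card,
      Fintype.card_fin, hchoose]
    rw [show 2 * m.succ - 1 = 2 * m + 1 by omega, Nat.succ_eq_add_one]
    exact le_of_eq (by ring)

end Skolem

end TripleSystems

theorem corollary2p9_general :
    (∀ i j : ℕ, 2 ≤ j → j < i → ∀ (V : Type*) (G : SimpleGraph V),
      IsBoundedCompetitionGraph i j G → G.cliqueNum < i * j - j + 1) ∧
    (∀ j : ℕ, ∃ (V : Type) (_ : Finite V) (G : SimpleGraph V),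
      IsBoundedCompetitionGraph 2 j G ∧ G.cliqueNum = j + 1) ∧
    (∀ j : ℕ, 1 ≤ j → ∀ (V : Type*) (G : SimpleGraph V),
      IsBoundedCompetitionGraph 3 j G → G.cliqueNum = 2 * j + 1 →
        j = 1 ∨ ∃ n : ℕ, 1 ≤ n ∧ (j = 3 * n ∨ j = 3 * n + 1)) ∧
    (∀ j : ℕ, (j = 1 ∨ ∃ n : ℕ, 1 ≤ n ∧ (j = 3 * n ∨ j = 3 * n + 1)) →
      ∃ (V : Type) (_ : Finite V) (G : SimpleGraph V),
        IsBoundedCompetitionGraph 3 j G ∧ G.cliqueNum = 2 * j + 1) := by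
  refine ⟨?_, exists_isBoundedCompetitionGraph_two, ?_, ?_⟩
  · rintro i j hj hij V _ ⟨D, hD, rfl⟩
    obtain ⟨k, rfl⟩ := Nat.exists_eq_succ_of_ne_zero (Nat.ne_zero_of_lt hij)
    rw [Nat.succ_mul, Nat.add_sub_cancel, mul_comm k]
    exact hD.cliqueNum_le.lt_of_ne fun hω ↦
      (Nat.lt_succ_iff.1 hij).not_gt (hD.lt_of_cliqueNum_eq hj hω)
  · rintro j hj V _ ⟨D, hD, rfl⟩ hω
    have hdvd : 3 ∣ (j * 2 + 1) * j := hD.succ_dvd_of_cliqueNum_eq two_pos (by rw [hω, mul_comm])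
    have hmod : j % 3 ≠ 2 := fun h ↦ by
      simpa [Nat.mul_mod, Nat.add_mod, h] using Nat.mod_eq_zero_of_dvd hdvd
    by_cases hone : j = 1
    · exact .inl hone
    · exact .inr ⟨j / 3, by omega, by omega⟩
  · intro j hj
    rw [mul_comm]
    obtain rfl | ⟨n, hn, rfl | rfl⟩ := hj
    · exact exists_isBoundedCompetitionGraph_bose 0
    · have : NeZero n := ⟨by omega⟩
      exact exists_isBoundedCompetitionGraph_skolem n
    · exact exists_isBoundedCompetitionGraph_bose n

theorem corollary2p9 :
    (∀ i j : ℕ, 2 ≤ j → j < i → ∀ (V : Type*) [Finite V] (G : SimpleGraph V),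
      IsBoundedCompetitionGraph i j G → G.cliqueNum < i * j - j + 1) ∧
    (∀ j : ℕ, 1 ≤ j → ∃ (V : Type) (_ : Finite V) (G : SimpleGraph V),
      IsBoundedCompetitionGraph 2 j G ∧ G.cliqueNum = j + 1) ∧
    (∀ j : ℕ, 1 ≤ j →
      ((∃ (V : Type) (_ : Finite V) (G : SimpleGraph V),
          IsBoundedCompetitionGraph 3 j G ∧ G.cliqueNum = 2 * j + 1) ↔
        j = 1 ∨ ∃ n : ℕ, 1 ≤ n ∧ (j = 3 * n ∨ j = 3 * n + 1))) := by
  obtain ⟨ha, hb, hc, hc'⟩ := corollary2p9_general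
  exact ⟨fun i j hj hij V _ ↦ ha i j hj hij V, fun j _ ↦ hb j, fun j hj ↦
    ⟨fun ⟨V, _, G, hG, hω⟩ ↦ hc j hj V G hG hω, hc' j⟩⟩
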